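/- Let $n\ge 0$, $q\ge 2$, $m_{\rm d},m_{\rm r}\ge 0$ be integers. Let $M,K\in\mathbb{R}^{n\times n}$ be symmetric positive definite, and suppose that the roots of the polynomial $\det(sM-K)$ are distinct. Let $C_{\rm d}\in\mathbb{R}^{m_{\rm d}\times n}$ and $C_{\rm r}\in\mathbb{R}^{m_{\rm r}\times n}$, and let $d_{ij},r_{ij}\ge 0$ $(i,j=1,\dots,q)$ be real scalars with $d_{ij}=d_{ji}$, $r_{ij}=r_{ji}$, $d_{ii}=r_{ii}=0$. For $\varepsilon>0$ consider the array of coupled oscillators $$M\ddot x_i+Kx_i+\sum_{j=1}^{q}d_{ij}C_{\rm d}^{T}C_{\rm d}(\dot x_i-\dot x_j)+\varepsilon\sum_{j=1}^{q}r_{ij}C_{\rm r}^{T}C_{\rm r}(x_i-x_j)=0,\qquad i=1,\dots,q,\qquad(\ast)$$ with $x_i(t)\in\mathbb{R}^n$, $t\ge 0$. The array $(\ast)$ is said to synchronize if for every solution (i.e. for all initial conditions) $\|x_i(t)-x_j(t)\|\to 0$ as $t\to\infty$ for all $i,j$. Let $\ell_{\rm d},\ell_{\rm r}\in\mathbb{R}^{q\times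 q}$ be the Laplacian matrices of the weights $(d_{ij})$ and $(r_{ij})$: the diagonal entries are $(\ell_{\rm d})_{ii}=\sum_{k}d_{ik}$ and the off-diagonal entries are $(\ell_{\rm d})_{ij}=-d_{ij}$, and likewise for $\ell_{\rm r}$ and $(r_{ij})$. For $X\in\mathbb{C}^{q\times q}$ let $\lambda_1(X),\dots,\lambda_q(X)$ be its eigenvalues, repeated according to algebraic multiplicity and ordered so that $\mathrm{Re}\,\lambda_1(X)\le\cdots\le\mathrm{Re}\,\lambda_q(X)$. A pair $(C,A)$ is called observable if, for the system $\dot z=Az$, $y=Cz$, two solutions with the same output $y(t)$ for all $t\ge 0$ have the same initial state $z(0)$. Let $j$ in $\ell_{\rm d}+j\ell_{\rm r}$ denote the imaginary unit. Suppose $\mathrm{Re}\,\lambda_2(\ell_{\rm d}+j\ell_{\rm r})>0$ and that both $(C_{\rm d},M^{-1}K)$ and $(C_{\rm r},M^{-1}K)$ are observable pairs. Then there exists $\rho>0$ such that the array $(\ast)$ synchronizes for all $\varepsilon\in(0,\rho)$. -/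

import Mathlib

open Matrix

noncomputable section

/-- A trajectory `x t i` (state of oscillator `i` at time `t ≥ 0`), with velocities `v` and
accelerations `a`, solves on `[0, ∞)` the array
`M ẍᵢ + K xᵢ + ∑ⱼ Dᵢⱼ (ẋᵢ - ẋⱼ) + ∑ⱼ Rᵢⱼ (xᵢ - xⱼ) = 0`, `i = 1, …, q`. -/
structure IsArraySolution {n q : ℕ} (M K : Matrix (Fin n) (Fin n) ℝ)
    (D R : Fin q → Fin q → Matrix (Fin n) (Fin n) ℝ)
    (x v a : ℝ → Fin q → Fin n → ℝ) : Prop where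
  hasDeriv_pos : ∀ t, 0 ≤ t → HasDerivWithinAt x (v t) (Set.Ici 0) t
  hasDeriv_vel : ∀ t, 0 ≤ t → HasDerivWithinAt v (a t) (Set.Ici 0) t
  equation : ∀ t, 0 ≤ t → ∀ i,
    M *ᵥ a t i + K *ᵥ x t i + ∑ j, D i j *ᵥ (v t i - v t j)
      + ∑ j, R i j *ᵥ (x t i - x t j) = 0

/-- The array synchronizes: along every solution (that is, for all initial conditions),
the Euclidean distance `‖xᵢ(t) - xⱼ(t)‖` tends to `0` as `t → ∞`, for all `i, j`. -/
def Synchronizes {n q : ℕ} (M K : Matrix (Fin n) (Fin n) ℝ)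
    (D R : Fin q → Fin q → Matrix (Fin n) (Fin n) ℝ) : Prop :=
  ∀ x v a : ℝ → Fin q → Fin n → ℝ, IsArraySolution M K D R x v a →
    ∀ i j, Filter.Tendsto (fun t => ‖WithLp.toLp 2 (x t i - x t j)‖) Filter.atTop (nhds 0)

/-- The scalar-weighted Laplacian `lap (wᵢⱼ)`: diagonal entries `∑ⱼ wᵢⱼ`, off-diagonal
entries `-wᵢⱼ`. -/
def lap {q : ℕ} (w : Fin q → Fin q → ℝ) : Matrix (Fin q) (Fin q) ℝ :=
  Matrix.of fun i j => if i = j then ∑ k, w i k else -w i j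

/-- The real parts of the eigenvalues of `X`, counted with algebraic multiplicity, in
nondecreasing order. -/
def sortedReEigenvalues {m : ℕ} (X : Matrix (Fin m) (Fin m) ℂ) : List ℝ :=
  (X.charpoly.roots.map Complex.re).sort (· ≤ ·)

theorem length_sortedReEigenvalues {m : ℕ} (X : Matrix (Fin m) (Fin m) ℂ) :
    (sortedReEigenvalues X).length = m := by
  rw [sortedReEigenvalues, Multiset.length_sort, Multiset.card_map,
    IsAlgClosed.card_roots_eq_natDegree, Matrix.charpoly_natDegree_eq_dim, Fintype.card_fin]

/-- `reEigenvalue X k` is `Re λₖ₊₁(X)` (the index `k` starts at `0`), where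
`λ₁(X), …, λₘ(X)` are the eigenvalues of `X`, repeated according to multiplicity and ordered
by nondecreasing real part. -/
def reEigenvalue {m : ℕ} (X : Matrix (Fin m) (Fin m) ℂ) (k : Fin m) : ℝ :=
  (sortedReEigenvalues X).get (k.cast (length_sortedReEigenvalues X).symm)

/-- The complex matrix `X + jY` built from two real matrices. -/
def complexCombine {m : ℕ} (X Y : Matrix (Fin m) (Fin m) ℝ) : Matrix (Fin m) (Fin m) ℂ :=
  X.map (fun s : ℝ => (s : ℂ)) + Complex.I • Y.map (fun s : ℝ => (s : ℂ))

/-- `z` solves `ż = A z` on `[0, ∞)`. -/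
def IsLinearTrajectory {n : ℕ} (A : Matrix (Fin n) (Fin n) ℝ) (z : ℝ → Fin n → ℝ) : Prop :=
  ∀ t, 0 ≤ t → HasDerivWithinAt z (A *ᵥ z t) (Set.Ici 0) t

/-- The pair `(C, A)` is observable: for the system `ż = A z`, `y = C z`, the output determines
the initial state. -/
def IsObservablePair {m n : ℕ} (C : Matrix (Fin m) (Fin n) ℝ)
    (A : Matrix (Fin n) (Fin n) ℝ) : Prop :=
  ∀ z w : ℝ → Fin n → ℝ, IsLinearTrajectory A z → IsLinearTrajectory A w →
    (∀ t, 0 ≤ t → C *ᵥ z t = C *ᵥ w t) → z 0 = w 0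

/-- The polynomial `d(s) = det (s M - K)`, whose roots are the eigenvalues of `K` with respect
to `M`. -/
def pencilPoly {n : ℕ} (M K : Matrix (Fin n) (Fin n) ℝ) : Polynomial ℝ :=
  ((Polynomial.X : Polynomial ℝ) • M.map Polynomial.C - K.map Polynomial.C).det

end

open scoped Kronecker

/-! Synchronization means that the deviations from the average decay. These obey a second order
system with mass `1 ⊗ M`, stiffness `1 ⊗ K + ε ℓ_r ⊗ C_rᵀC_r` and damping `ℓ_d ⊗ C_dᵀC_d`. Since
deviations sum to zero, adding `J ⊗ M` (with `J` all ones) to the damping leaves their equation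
unchanged, while it damps the synchronized motions. By `tendsto_zero_of_no_undamped_mode`, decay
follows once no nonzero real mode lies in the kernel of the damping.

Small `ε` excludes such modes (`exists_no_undamped_mode`). Otherwise, by compactness, undamped modes
for some `ε → 0` converge to an undamped mode at `ε = 0` (`exists_limit_mode`). As the pencil has
simple eigenvalues, its blocks are `γ i • v` for a single eigenvector `v`. Vanishing damping and
observability of `C_d` give `∑ γ = 0` and `ℓ_d γ = 0`. First order perturbation in `ε`, with
observability of `C_r`, gives `ℓ_r γ = ν γ`. Then the constant vector and `γ` are independent
eigenvectors of `ℓ_d + jℓ_r` with eigenvalues `0` and `jν`, contradicting `Re λ₂ > 0`. -/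

/-! ### Asymptotic stability of damped second order systems. -/

theorem tendsto_zero_of_hasDerivWithinAt_linear {y f : ℝ → ℂ} {l : ℂ} (hl : l.re < 0)
    (hy : ∀ t, 0 ≤ t → HasDerivWithinAt y (l * y t + f t) (Set.Ici 0) t)
    (hf : Filter.Tendsto f Filter.atTop (nhds 0)) :
    Filter.Tendsto y Filter.atTop (nhds 0) := by
  set s : ℝ := -l.re with hs
  have hspos : 0 < s := by simp [hs, hl]
  have hderiv : ∀ t, 0 ≤ t → HasDerivWithinAt (fun t => (y t).re ^ 2 + (y t).im ^ 2)
      (2 * (y t).re * (l * y t + f t).re + 2 * (y t).im * (l * y t + f t).im)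
      (Set.Ici 0) t := by
    intro t ht
    have hre : HasDerivWithinAt (fun t => (y t).re) (l * y t + f t).re (Set.Ici 0) t :=
      Complex.reCLM.hasFDerivAt.comp_hasDerivWithinAt t (hy t ht)
    have him : HasDerivWithinAt (fun t => (y t).im) (l * y t + f t).im (Set.Ici 0) t :=
      Complex.imCLM.hasFDerivAt.comp_hasDerivWithinAt t (hy t ht)
    refine ((hre.fun_pow 2).add (him.fun_pow 2)).congr_deriv ?_
    norm_num
  set g : ℝ → ℝ := fun t => (y t).re ^ 2 + (y t).im ^ 2 with hg
  have hg0 : ∀ t, 0 ≤ g t := fun t => by positivity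
  have key : Filter.Tendsto g Filter.atTop (nhds 0) := by
    rw [Metric.tendsto_atTop]
    intro ε hε
    have hf2 : Filter.Tendsto (fun t => (f t).re ^ 2 + (f t).im ^ 2) Filter.atTop (nhds 0) := by
      have h := ((Complex.continuous_re.tendsto _).comp hf).pow 2 |>.add
        (((Complex.continuous_im.tendsto _).comp hf).pow 2)
      simpa using h
    -- The threshold `s² ε / 2` on `|f|²` is what gives `g' ≤ -s (g - ε / 2)` below.
    have hev := (hf2.eventually (gt_mem_nhds (show 0 < s ^ 2 * (ε / 2) by positivity))).and
      (Filter.eventually_ge_atTop 0)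
    obtain ⟨T, hT⟩ := Filter.eventually_atTop.1 hev
    have hT0 : 0 ≤ T := (hT T le_rfl).2
    have hanti : AntitoneOn (fun t => Real.exp (s * t) * (g t - ε / 2)) (Set.Ici T) := by
      have hd : ∀ t, T ≤ t → HasDerivWithinAt (fun t => Real.exp (s * t) * (g t - ε / 2))
          (Real.exp (s * t) * s * (g t - ε / 2) + Real.exp (s * t) *
          (2 * (y t).re * (l * y t + f t).re + 2 * (y t).im * (l * y t + f t).im))
          (Set.Ici 0) t := by
        intro t ht
        have h1 : HasDerivWithinAt (fun t => Real.exp (s * t)) (Real.exp (s * t) * s)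
            (Set.Ici 0) t := by
          simpa using (((hasDerivAt_id t).const_mul s).exp).hasDerivWithinAt
        exact h1.mul ((hderiv t (hT0.trans ht)).sub_const _)
      apply antitoneOn_of_deriv_nonpos (convex_Ici T)
      · intro t ht
        exact (hd t ht).continuousWithinAt.mono (Set.Ici_subset_Ici.2 hT0)
      · intro t ht
        rw [interior_Ici] at ht
        exact ((hd t (le_of_lt ht)).hasDerivAt
          (Ici_mem_nhds (hT0.trans_lt ht))).differentiableAt.differentiableWithinAt
      · intro t ht
        rw [interior_Ici] at ht
        rw [((hd t (le_of_lt ht)).hasDerivAt (Ici_mem_nhds (hT0.trans_lt ht))).deriv]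
        have hb := (hT t (le_of_lt ht)).1
        rw [mul_assoc, ← mul_add]
        apply mul_nonpos_of_nonneg_of_nonpos (Real.exp_pos _).le
        have hlre : l.re = -s := by simp [hs]
        simp only [Complex.add_re, Complex.add_im, Complex.mul_re, Complex.mul_im, hlre, hg]
        -- Completing the square: `2s Re(ȳ f) ≤ s² |y|² + |f|²`.
        have e1 : 0 ≤ (s * (y t).re - (f t).re) ^ 2 + (s * (y t).im - (f t).im) ^ 2 := by
          positivity
        have : s * (s * ((y t).re ^ 2 + (y t).im ^ 2 - ε / 2) +
            (2 * (y t).re * (-s * (y t).re - l.im * (y t).im + (f t).re) +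
              2 * (y t).im * (-s * (y t).im + l.im * (y t).re + (f t).im))) ≤ 0 := by
          nlinarith
        exact nonpos_of_mul_nonpos_right this hspos
    have hlim : Filter.Tendsto (fun t => Real.exp (-(s * t)) * (Real.exp (s * T) * (g T - ε / 2)))
        Filter.atTop (nhds 0) := by
      have h1 : Filter.Tendsto (fun t => Real.exp (-(s * t))) Filter.atTop (nhds 0) :=
        Real.tendsto_exp_neg_atTop_nhds_zero.comp
          (Filter.tendsto_id.const_mul_atTop hspos)
      simpa using h1.mul_const (Real.exp (s * T) * (g T - ε / 2))
    obtain ⟨T', hT'⟩ := Filter.eventually_atTop.1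
      (hlim.eventually (gt_mem_nhds (show 0 < ε / 2 by positivity)))
    refine ⟨max T T', fun t ht => ?_⟩
    have h1 := hanti (Set.self_mem_Ici) (Set.mem_Ici.2 ((le_max_left _ _).trans ht))
      ((le_max_left _ _).trans ht)
    have h2 := hT' t ((le_max_right _ _).trans ht)
    simp only at h1
    have h3 : g t - ε / 2 ≤ Real.exp (-(s * t)) * (Real.exp (s * T) * (g T - ε / 2)) := by
      have := mul_le_mul_of_nonneg_left h1 (Real.exp_pos (-(s * t))).le
      rwa [← mul_assoc, ← Real.exp_add, neg_add_cancel, Real.exp_zero, one_mul] at this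
    rw [Real.dist_eq, sub_zero, abs_of_nonneg (hg0 t)]
    linarith
  rw [tendsto_zero_iff_norm_tendsto_zero]
  have := (Real.continuous_sqrt.tendsto 0).comp key
  rw [Real.sqrt_zero] at this
  refine this.congr fun t => ?_
  simp [hg, Complex.norm_eq_sqrt_sq_add_sq]

section Stability

variable {N : Type*} [Fintype N]

theorem map_mulVec_re (A : Matrix N N ℝ) (p : N → ℂ) (i : N) :
    ((A.map Complex.ofRealHom *ᵥ p) i).re = (A *ᵥ fun j => (p j).re) i := by
  simp [mulVec, dotProduct, Complex.re_sum]

theorem map_mulVec_im (A : Matrix N N ℝ) (p : N → ℂ) (i : N) :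
    ((A.map Complex.ofRealHom *ᵥ p) i).im = (A *ᵥ fun j => (p j).im) i := by
  simp [mulVec, dotProduct, Complex.im_sum]

/-- Symmetry cancels the cross terms between real and imaginary parts. -/
theorem star_dotProduct_map_mulVec {A : Matrix N N ℝ} (hA : A.IsHermitian) (p : N → ℂ) :
    star p ⬝ᵥ (A.map Complex.ofRealHom *ᵥ p) =
      (((fun j => (p j).re) ⬝ᵥ (A *ᵥ fun j => (p j).re) +
        (fun j => (p j).im) ⬝ᵥ (A *ᵥ fun j => (p j).im) : ℝ) : ℂ) := by
  have hsymm : (fun j => (p j).im) ⬝ᵥ (A *ᵥ fun j => (p j).re) =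
      (fun j => (p j).re) ⬝ᵥ (A *ᵥ fun j => (p j).im) := by
    rw [dotProduct_mulVec, ← mulVec_transpose, dotProduct_comm,
      ← conjTranspose_eq_transpose_of_trivial, hA]
  apply Complex.ext
  · simp only [dotProduct, Complex.re_sum, Complex.ofReal_re, Pi.star_apply, Complex.mul_re,
      map_mulVec_re, map_mulVec_im, Complex.star_def, Complex.conj_re, Complex.conj_im,
      ← Finset.sum_add_distrib]
    exact Finset.sum_congr rfl fun i _ => by ring
  · simp only [dotProduct] at hsymm
    simp only [dotProduct, Complex.im_sum, Complex.ofReal_im, Pi.star_apply, Complex.mul_im,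
      map_mulVec_re, map_mulVec_im, Complex.star_def, Complex.conj_re, Complex.conj_im,
      Finset.sum_add_distrib, neg_mul, Finset.sum_neg_distrib, hsymm, add_neg_cancel]

/-- The transposed generator of `M ẍ + D ẋ + K x = 0`: the functional `φ · x + ψ · M ẋ` has the
derivative `φ' · x + ψ' · M ẋ` with `(φ', ψ')` the image of `(φ, ψ)`. -/
noncomputable def dualGenerator [DecidableEq N] (M D K : Matrix N N ℝ) :
    Module.End ℂ ((N → ℂ) × (N → ℂ)) :=
  LinearMap.prod
    (-((K.map Complex.ofRealHom).mulVecLin ∘ₗ LinearMap.snd ℂ _ _))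
    ((M⁻¹.map Complex.ofRealHom).mulVecLin ∘ₗ
      (LinearMap.fst ℂ _ _ - (D.map Complex.ofRealHom).mulVecLin ∘ₗ LinearMap.snd ℂ _ _))

theorem re_neg_of_quadratic {m d k : ℝ} {l : ℂ} (hm : 0 < m) (hd : 0 < d) (hk : 0 < k)
    (h : l ^ 2 * m + l * d + k = 0) : l.re < 0 := by
  by_contra! hl
  have hre := congrArg Complex.re h
  have him := congrArg Complex.im h
  simp [pow_two] at hre him
  have h1 : l.im * (2 * l.re * m + d) = 0 := by linarith
  have h2 : l.im = 0 := by
    rcases mul_eq_zero.1 h1 with h | h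
    · exact h
    · nlinarith [mul_nonneg hl hm.le]
  rw [h2] at hre
  nlinarith [mul_nonneg hl hd.le, mul_nonneg (mul_nonneg hl hl) hm.le]

/-- Eliminating `φ` leaves `(l² M + l D + K) ψ = 0`; pairing with `ψ*` gives a real quadratic in `l`
with positive outer coefficients. Its middle coefficient vanishes only if `ψ` is undamped, which
`hmode` excludes. -/
theorem re_neg_of_dualGenerator_eigenvector [DecidableEq N] {M D K : Matrix N N ℝ} (hM : M.PosDef)
    (hD : D.PosSemidef) (hK : K.PosDef)
    (hmode : ∀ (u : N → ℝ) (μ : ℝ), D *ᵥ u = 0 → K *ᵥ u = μ • (M *ᵥ u) → u = 0)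
    {l : ℂ} {p : (N → ℂ) × (N → ℂ)} (hp : p ≠ 0) (h : dualGenerator M D K p = l • p) :
    l.re < 0 := by
  obtain ⟨φ, ψ⟩ := p
  have h1 : -(K.map Complex.ofRealHom *ᵥ ψ) = l • φ := congrArg Prod.fst h
  have h2 : M⁻¹.map Complex.ofRealHom *ᵥ (φ - D.map Complex.ofRealHom *ᵥ ψ) = l • ψ :=
    congrArg Prod.snd h
  have hMM : M.map Complex.ofRealHom * M⁻¹.map Complex.ofRealHom = 1 := by
    rw [← Matrix.map_mul, mul_nonsing_inv _ ((isUnit_iff_isUnit_det _).1 hM.isUnit)]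
    simp
  have h3 : φ = l • (M.map Complex.ofRealHom *ᵥ ψ) + D.map Complex.ofRealHom *ᵥ ψ := by
    rw [← mulVec_smul, ← h2, mulVec_mulVec, hMM, one_mulVec, sub_add_cancel]
  have hψ : ψ ≠ 0 := by
    rintro rfl
    apply hp
    simp [h3]
  have hquad : l ^ 2 • (M.map Complex.ofRealHom *ᵥ ψ) + l • (D.map Complex.ofRealHom *ᵥ ψ)
      + K.map Complex.ofRealHom *ᵥ ψ = 0 := by
    rw [h3, smul_add, smul_smul, ← pow_two] at h1
    rw [← h1, neg_add_cancel]
  set a : N → ℝ := fun j => (ψ j).re with ha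
  set b : N → ℝ := fun j => (ψ j).im with hb
  have hab : a ≠ 0 ∨ b ≠ 0 := by
    by_contra! hc
    apply hψ
    funext j
    exact Complex.ext (congrFun hc.1 j) (congrFun hc.2 j)
  have hposdef : ∀ {A : Matrix N N ℝ}, A.PosDef → 0 < a ⬝ᵥ (A *ᵥ a) + b ⬝ᵥ (A *ᵥ b) := by
    intro A hA
    have ea := hA.posSemidef.dotProduct_mulVec_nonneg a
    have eb := hA.posSemidef.dotProduct_mulVec_nonneg b
    rw [star_trivial] at ea eb
    rcases hab with h | h
    · have := hA.dotProduct_mulVec_pos h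
      rw [star_trivial] at this
      linarith
    · have := hA.dotProduct_mulVec_pos h
      rw [star_trivial] at this
      linarith
  have hscal := congrArg (fun w => star ψ ⬝ᵥ w) hquad
  simp only [dotProduct_add, dotProduct_smul, dotProduct_zero, smul_eq_mul,
    star_dotProduct_map_mulVec hM.isHermitian, star_dotProduct_map_mulVec hD.isHermitian,
    star_dotProduct_map_mulVec hK.isHermitian] at hscal
  rw [← ha, ← hb] at hscal
  have ea := hD.dotProduct_mulVec_nonneg a
  have eb := hD.dotProduct_mulVec_nonneg b
  rw [star_trivial] at ea eb
  rcases (add_nonneg ea eb).lt_or_eq with hd | hd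
  · exact re_neg_of_quadratic (hposdef hM) hd (hposdef hK) hscal
  · exfalso
    have hDa : D *ᵥ a = 0 := (hD.dotProduct_mulVec_zero_iff a).1 (by rw [star_trivial]; linarith)
    have hDb : D *ᵥ b = 0 := (hD.dotProduct_mulVec_zero_iff b).1 (by rw [star_trivial]; linarith)
    have hDψ : D.map Complex.ofRealHom *ᵥ ψ = 0 := by
      funext j
      apply Complex.ext
      · rw [map_mulVec_re]; exact congrFun hDa j
      · rw [map_mulVec_im]; exact congrFun hDb j
    rw [← hd, Complex.ofReal_zero, mul_zero, add_zero] at hscal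
    set m := a ⬝ᵥ (M *ᵥ a) + b ⬝ᵥ (M *ᵥ b)
    set k := a ⬝ᵥ (K *ᵥ a) + b ⬝ᵥ (K *ᵥ b)
    have hm : 0 < m := hposdef hM
    -- Now `l²` is real, so the real and imaginary parts of `ψ` are separately real undamped modes.
    have hl : l ^ 2 = ((-(k / m) : ℝ) : ℂ) := by
      have hm' : (m : ℂ) ≠ 0 := by exact_mod_cast hm.ne'
      push_cast
      field_simp
      linear_combination hscal
    rw [hDψ, smul_zero, add_zero, hl] at hquad
    have hKψ : ∀ j, (K.map Complex.ofRealHom *ᵥ ψ) j =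
        ((k / m : ℝ) : ℂ) * (M.map Complex.ofRealHom *ᵥ ψ) j := by
      intro j
      have := congrFun hquad j
      simp only [Pi.add_apply, Pi.smul_apply, smul_eq_mul, Pi.zero_apply] at this
      rw [Complex.ofReal_neg] at this
      linear_combination this
    rcases hab with h | h
    · refine h (hmode a (k / m) hDa (funext fun j => ?_))
      have := congrArg Complex.re (hKψ j)
      rwa [Complex.re_ofReal_mul, map_mulVec_re, map_mulVec_re] at this
    · refine h (hmode b (k / m) hDb (funext fun j => ?_))
      have := congrArg Complex.im (hKψ j)
      rwa [Complex.im_ofReal_mul, map_mulVec_im, map_mulVec_im] at this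

/-- The functional `φ · x + ψ · w` on real vectors, for complex `φ, ψ`. -/
noncomputable def phaseFunctional (p : (N → ℂ) × (N → ℂ)) (x w : N → ℝ) : ℂ :=
  p.1 ⬝ᵥ (Complex.ofRealHom ∘ x) + p.2 ⬝ᵥ (Complex.ofRealHom ∘ w)

/-- In the state `(x, Mẋ)` the flow is `(ẋ, -Dẋ - Kx)`; symmetry of `M⁻¹`, `D`, `K` moves these
matrices onto the functional. Stability thus reduces to scalar equations. -/
theorem hasDerivWithinAt_phaseFunctional [DecidableEq N] {M D K : Matrix N N ℝ} (hM : M.PosDef)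
    (hD : D.IsHermitian) (hK : K.IsHermitian) {x v a : ℝ → N → ℝ} {s : Set ℝ} {t : ℝ}
    (hx : HasDerivWithinAt x (v t) s t) (hv : HasDerivWithinAt v (a t) s t)
    (heq : M *ᵥ a t + D *ᵥ v t + K *ᵥ x t = 0) (p : (N → ℂ) × (N → ℂ)) :
    HasDerivWithinAt (fun t => phaseFunctional p (x t) (M *ᵥ v t))
      (phaseFunctional (dualGenerator M D K p) (x t) (M *ᵥ v t)) s t := by
  have hMv : HasDerivWithinAt (fun t => M *ᵥ v t) (M *ᵥ a t) s t :=
    (LinearMap.toContinuousLinearMap M.mulVecLin).hasFDerivAt.comp_hasDerivWithinAt t hv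
  have hdot : ∀ (φ : N → ℂ) {z : ℝ → N → ℝ} {z' : N → ℝ}, HasDerivWithinAt z z' s t →
      HasDerivWithinAt (fun t => φ ⬝ᵥ (Complex.ofRealHom ∘ z t))
        (φ ⬝ᵥ (Complex.ofRealHom ∘ z')) s t := by
    intro φ z z' hz
    rw [hasDerivWithinAt_pi] at hz
    exact HasDerivWithinAt.fun_sum fun i _ => ((hz i).ofReal_comp).const_mul (φ i)
  refine ((hdot p.1 hx).add (hdot p.2 hMv)).congr_deriv ?_
  have hmap : ∀ (A : Matrix N N ℝ) (z : N → ℝ), Complex.ofRealHom ∘ (A *ᵥ z) =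
      A.map Complex.ofRealHom *ᵥ (Complex.ofRealHom ∘ z) :=
    fun A z => funext fun i => RingHom.map_mulVec _ A z i
  have hsymm : ∀ {A : Matrix N N ℝ}, A.IsHermitian → ∀ φ χ : N → ℂ,
      (A.map Complex.ofRealHom *ᵥ φ) ⬝ᵥ χ = φ ⬝ᵥ (A.map Complex.ofRealHom *ᵥ χ) := by
    intro A hA φ χ
    have hT : (A.map Complex.ofRealHom)ᵀ = A.map Complex.ofRealHom := by
      rw [← transpose_map, ← conjTranspose_eq_transpose_of_trivial, hA]
    rw [dotProduct_mulVec φ, ← mulVec_transpose, hT]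
  have hMM : M⁻¹.map Complex.ofRealHom * M.map Complex.ofRealHom = 1 := by
    rw [← Matrix.map_mul, nonsing_inv_mul _ ((isUnit_iff_isUnit_det _).1 hM.isUnit)]
    simp
  have hMa : M *ᵥ a t = -(D *ᵥ v t) - K *ᵥ x t := by
    rw [← sub_eq_zero, ← heq]; abel
  have hneg : Complex.ofRealHom ∘ (-(D *ᵥ v t) - K *ᵥ x t) =
      -(Complex.ofRealHom ∘ (D *ᵥ v t)) - Complex.ofRealHom ∘ (K *ᵥ x t) := by
    funext i; simp
  rw [hMa, hneg]
  simp only [phaseFunctional, dualGenerator, LinearMap.prod_apply, Function.prod_apply,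
    LinearMap.neg_apply, LinearMap.comp_apply, LinearMap.sub_apply, LinearMap.fst_apply,
    LinearMap.snd_apply, mulVecLin_apply, neg_dotProduct]
  rw [hsymm hK, hsymm hM.inv.isHermitian, hmap M, mulVec_mulVec, hMM, one_mulVec, sub_dotProduct,
    hsymm hD, dotProduct_sub, dotProduct_neg, hmap, hmap]
  ring

/-- A damped second order system without undamped modes is asymptotically stable. -/
theorem tendsto_zero_of_no_undamped_mode [DecidableEq N] {M D K : Matrix N N ℝ} (hM : M.PosDef)
    (hD : D.PosSemidef) (hK : K.PosDef)
    (hmode : ∀ (u : N → ℝ) (μ : ℝ), D *ᵥ u = 0 → K *ᵥ u = μ • (M *ᵥ u) → u = 0)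
    {x v a : ℝ → N → ℝ}
    (hx : ∀ t, 0 ≤ t → HasDerivWithinAt x (v t) (Set.Ici 0) t)
    (hv : ∀ t, 0 ≤ t → HasDerivWithinAt v (a t) (Set.Ici 0) t)
    (heq : ∀ t, 0 ≤ t → M *ᵥ a t + D *ᵥ v t + K *ᵥ x t = 0) :
    Filter.Tendsto x Filter.atTop (nhds 0) := by
  set T := dualGenerator M D K with hT
  have hgen : ∀ (l : ℂ) (k : ℕ) (p : (N → ℂ) × (N → ℂ)), ((T - l • (1 : Module.End ℂ ((N → ℂ) × (N → ℂ)))) ^ k) p = 0 →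
      Filter.Tendsto (fun t => phaseFunctional p (x t) (M *ᵥ v t)) Filter.atTop (nhds 0) := by
    intro l k
    by_cases hl : l.re < 0
    · induction k with
      | zero =>
        intro p hp
        rw [pow_zero, Module.End.one_apply] at hp
        subst hp
        simp [phaseFunctional]
      | succ k ih =>
        intro p hp
        rw [pow_succ, Module.End.mul_apply] at hp
        -- Along a Jordan chain the functional of `p` satisfies `y' = l y + f`, where `f` is the
        -- functional of `(T - l) p`, already known to decay.
        refine tendsto_zero_of_hasDerivWithinAt_linear hl (fun t ht => ?_) (ih _ hp)
        convert hasDerivWithinAt_phaseFunctional hM hD.isHermitian hK.isHermitian (hx t ht)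
          (hv t ht) (heq t ht) p using 1
        simp only [phaseFunctional, LinearMap.sub_apply, LinearMap.smul_apply, Module.End.one_apply,
          Prod.fst_sub, Prod.snd_sub, Prod.smul_fst, Prod.smul_snd, sub_dotProduct,
          smul_dotProduct, smul_eq_mul]
        rw [← hT]
        ring
    · intro p hp
      -- An eigenvalue must have negative real part, so here the generalized eigenspace is trivial.
      have hinj : Function.Injective (T - l • (1 : Module.End ℂ ((N → ℂ) × (N → ℂ)))) := by
        rw [injective_iff_map_eq_zero]
        intro p hp
        by_contra hne
        apply hl
        refine re_neg_of_dualGenerator_eigenvector hM hD hK hmode hne ?_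
        rwa [LinearMap.sub_apply, sub_eq_zero, LinearMap.smul_apply, Module.End.one_apply] at hp
      have hp0 : p = 0 := by
        apply hinj.iterate k
        rw [← Module.End.pow_apply, hp, ← Module.End.pow_apply, map_zero]
      subst hp0
      simp [phaseFunctional]
  have hall : ∀ p : (N → ℂ) × (N → ℂ),
      Filter.Tendsto (fun t => phaseFunctional p (x t) (M *ᵥ v t)) Filter.atTop (nhds 0) := by
    intro p
    have hp : p ∈ ⨆ l, T.maxGenEigenspace l := by
      rw [Module.End.iSup_maxGenEigenspace_eq_top]; trivial
    refine Submodule.iSup_induction (fun l => T.maxGenEigenspace l) (motive := fun p =>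
      Filter.Tendsto (fun t => phaseFunctional p (x t) (M *ᵥ v t)) Filter.atTop (nhds 0))
      hp ?_ ?_ ?_
    · intro l p hp
      obtain ⟨k, hk⟩ := (Module.End.mem_maxGenEigenspace T l p).1 hp
      exact hgen l k p hk
    · simp [phaseFunctional]
    · intro p p' h h'
      have := h.add h'
      rw [add_zero] at this
      refine this.congr fun t => ?_
      simp only [phaseFunctional, Prod.fst_add, Prod.snd_add, add_dotProduct]
      ring
  rw [tendsto_pi_nhds]
  intro i
  have h := (Complex.continuous_re.tendsto _).comp (hall (Pi.single i 1, 0))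
  refine h.congr fun t => ?_
  simp [phaseFunctional]

end Stability

/-! ### Eigenvalue multiplicities and the second smallest real part. -/

theorem two_le_rootMultiplicity_charpoly {F : Type*} [Field F] {m : ℕ}
    {A : Matrix (Fin m) (Fin m) F} {l : F} {v w : Fin m → F} (hvw : LinearIndependent F ![v, w])
    (hv : A *ᵥ v = l • v) (hw : A *ᵥ w = l • w) : 2 ≤ A.charpoly.rootMultiplicity l := by
  have hle := LinearMap.finrank_eigenspace_le (toLin' A) l
  rw [charpoly_toLin'] at hle
  refine le_trans ?_ hle
  let f : Fin 2 → Module.End.eigenspace (toLin' A) l :=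
    ![⟨v, by rwa [Module.End.mem_eigenspace_iff, toLin'_apply]⟩,
      ⟨w, by rwa [Module.End.mem_eigenspace_iff, toLin'_apply]⟩]
  have hcoe : Submodule.subtype _ ∘ f = ![v, w] := by
    funext i
    fin_cases i <;> rfl
  have hf : LinearIndependent F f :=
    LinearIndependent.of_comp (Submodule.subtype _) (by rwa [hcoe])
  simpa using hf.fintype_card_le_finrank

theorem mem_roots_charpoly_of_mulVec {F : Type*} [Field F] {m : ℕ}
    {A : Matrix (Fin m) (Fin m) F} {l : F} {v : Fin m → F} (hv0 : v ≠ 0)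
    (hv : A *ᵥ v = l • v) : l ∈ A.charpoly.roots := by
  rw [Polynomial.mem_roots (charpoly_monic A).ne_zero, ← charpoly_toLin',
    ← Module.End.hasEigenvalue_iff_isRoot_charpoly]
  exact Module.End.hasEigenvalue_of_hasEigenvector (x := v)
    ⟨by rwa [Module.End.mem_eigenspace_iff, toLin'_apply], hv0⟩

theorem sort_get_one_nonpos {s : Multiset ℝ} (hs : Multiset.replicate 2 0 ≤ s)
    (h : 1 < (s.sort (· ≤ ·)).length) : (s.sort (· ≤ ·)).get ⟨1, h⟩ ≤ 0 := by
  have hcount : 2 ≤ (s.sort (· ≤ ·)).count 0 := by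
    rw [← Multiset.coe_count, Multiset.sort_eq]
    exact Multiset.le_count_iff_replicate_le.2 hs
  have hsorted := s.pairwise_sort (· ≤ ·)
  generalize s.sort (· ≤ ·) = L at *
  match L, h with
  | a :: b :: L, _ =>
    by_contra! hb
    simp only [List.get_eq_getElem, List.getElem_cons_succ, List.getElem_cons_zero] at hb
    have h0 : (b :: L).count 0 = 0 := by
      rw [List.count_eq_zero]
      intro hmem
      rcases List.mem_cons.1 hmem with h | h
      · exact hb.ne h
      · exact absurd (List.rel_of_pairwise_cons (List.pairwise_cons.1 hsorted).2 h) (not_le.2 hb)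
    rw [List.count_cons, h0] at hcount
    split_ifs at hcount <;> omega

/-- Two roots, counted with multiplicity, lie on the imaginary axis. Distinct roots suffice for `ν ≠
0`; for `ν = 0` the independence of `v` and `w` makes `0` a double root. -/
theorem reEigenvalue_one_nonpos {q : ℕ} (hq : 2 ≤ q) {X : Matrix (Fin q) (Fin q) ℂ} {ν : ℝ}
    {v w : Fin q → ℂ} (hvw : LinearIndependent ℂ ![v, w]) (hv : X *ᵥ v = 0)
    (hw : X *ᵥ w = (Complex.I * ν) • w) : reEigenvalue X ⟨1, hq⟩ ≤ 0 := by
  apply sort_get_one_nonpos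
  have hv0 : v ≠ 0 := hvw.ne_zero 0
  have hw0 : w ≠ 0 := hvw.ne_zero 1
  rw [← zero_smul ℂ v] at hv
  by_cases hν : ν = 0
  · subst hν
    rw [Complex.ofReal_zero, mul_zero] at hw
    have h := two_le_rootMultiplicity_charpoly hvw hv hw
    rw [← Polynomial.count_roots, Multiset.le_count_iff_replicate_le] at h
    simpa using Multiset.map_le_map (f := Complex.re) h
  · have hne : (0 : ℂ) ≠ Complex.I * ν := by simpa using hν
    have h : ({0, Complex.I * ν} : Multiset ℂ) ≤ X.charpoly.roots := by
      refine (Multiset.le_iff_subset ?_).2 ?_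
      · simpa using hν
      · intro z hz
        simp only [Multiset.insert_eq_cons, Multiset.mem_cons, Multiset.mem_singleton] at hz
        rcases hz with rfl | rfl
        · exact mem_roots_charpoly_of_mulVec hv0 hv
        · exact mem_roots_charpoly_of_mulVec hw0 hw
    have h2 := Multiset.map_le_map (f := Complex.re) h
    convert h2 using 1
    simp [Multiset.replicate_succ]

/-! ### The pencil of `M` and `K`, observability, and limits of modes. -/

theorem pencilPoly_eq {n : ℕ} {M : Matrix (Fin n) (Fin n) ℝ} (hM : IsUnit M.det)
    (K : Matrix (Fin n) (Fin n) ℝ) :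
    pencilPoly M K = Polynomial.C M.det * (M⁻¹ * K).charpoly := by
  rw [pencilPoly, charpoly, charmatrix, RingHom.map_det, ← det_mul, mul_sub,
    RingHom.mapMatrix_apply, RingHom.mapMatrix_apply, ← Matrix.map_mul,
    mul_nonsing_inv_cancel_left _ _ hM, scalar_apply, ← smul_eq_mul_diagonal]

/-- A two-dimensional eigenspace of `M⁻¹K` would force a double root of the pencil polynomial. -/
theorem exists_smul_of_pencil_eigenvector {n : ℕ} {M K : Matrix (Fin n) (Fin n) ℝ} (hM : M.PosDef)
    (hdistinct : (pencilPoly M K).roots.Nodup) {μ : ℝ} {v w : Fin n → ℝ} (hv0 : v ≠ 0)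
    (hv : K *ᵥ v = μ • (M *ᵥ v)) (hw : K *ᵥ w = μ • (M *ᵥ w)) : ∃ c : ℝ, w = c • v := by
  have hdet : IsUnit M.det := (isUnit_iff_isUnit_det _).1 hM.isUnit
  by_contra! hc
  have hli : LinearIndependent ℝ ![v, w] := by
    rw [LinearIndependent.pair_iff' hv0]
    exact fun a h => hc a h.symm
  have hA : ∀ {u : Fin n → ℝ}, K *ᵥ u = μ • (M *ᵥ u) → (M⁻¹ * K) *ᵥ u = μ • u := by
    intro u hu
    rw [← mulVec_mulVec, hu, mulVec_smul, mulVec_mulVec, nonsing_inv_mul _ hdet, one_mulVec]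
  have h := two_le_rootMultiplicity_charpoly hli (hA hv) (hA hw)
  rw [pencilPoly_eq hdet, Polynomial.roots_C_mul _ hdet.ne_zero, Multiset.nodup_iff_count_le_one]
    at hdistinct
  rw [← Polynomial.count_roots] at h
  exact absurd (hdistinct μ) (by omega)

/-- If `C v = 0`, the trajectory `exp (μ t) v` has the same output as the zero trajectory. -/
theorem mulVec_ne_zero_of_isObservablePair {m n : ℕ} {C : Matrix (Fin m) (Fin n) ℝ}
    {A : Matrix (Fin n) (Fin n) ℝ} (h : IsObservablePair C A) {μ : ℝ} {v : Fin n → ℝ}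
    (hv0 : v ≠ 0) (hv : A *ᵥ v = μ • v) : C *ᵥ v ≠ 0 := by
  intro hC
  apply hv0
  have := h (fun t => Real.exp (μ * t) • v) (fun _ => 0) ?_ ?_ ?_
  · simpa using this
  · intro t _
    have h1 : HasDerivAt (fun t => Real.exp (μ * t)) (Real.exp (μ * t) * μ) t := by
      simpa using ((hasDerivAt_id t).const_mul μ).exp
    refine (h1.smul_const v).hasDerivWithinAt.congr_deriv ?_
    rw [mulVec_smul, hv, smul_smul]
  · intro t _
    simpa using hasDerivWithinAt_const t (Set.Ici 0) (0 : Fin n → ℝ)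
  · intro t _
    simp [mulVec_smul, hC]

/-- If undamped modes of `(M, K + ε R, D)` exist for arbitrarily small `ε`, then a sequence of them
converges to an undamped mode of `(M, K, D)`. -/
theorem exists_limit_mode {N : Type*} [Fintype N] {M K R D : Matrix N N ℝ} (hM : M.PosDef)
    (h : ∀ ρ : ℝ, 0 < ρ → ∃ ε : ℝ, 0 < ε ∧ ε < ρ ∧ ∃ (u : N → ℝ) (μ : ℝ), D *ᵥ u = 0 ∧
      (K + ε • R) *ᵥ u = μ • (M *ᵥ u) ∧ u ≠ 0) :
    ∃ (ε μ : ℕ → ℝ) (u : ℕ → N → ℝ) (μ₀ : ℝ) (u₀ : N → ℝ),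
      (∀ k, 0 < ε k ∧ (K + ε k • R) *ᵥ u k = μ k • (M *ᵥ u k)) ∧
      Filter.Tendsto u Filter.atTop (nhds u₀) ∧ u₀ ≠ 0 ∧ D *ᵥ u₀ = 0 ∧
      K *ᵥ u₀ = μ₀ • (M *ᵥ u₀) := by
  have hseq : ∀ k : ℕ, ∃ ε : ℝ, 0 < ε ∧ ε < 1 / ((k : ℝ) + 1) ∧ ∃ (u : N → ℝ) (μ : ℝ),
      D *ᵥ u = 0 ∧ (K + ε • R) *ᵥ u = μ • (M *ᵥ u) ∧ u ≠ 0 :=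
    fun k => h _ Nat.one_div_pos_of_nat
  choose ε hε hεlt u μ hD heq hu using hseq
  have hmem : ∀ k, ‖u k‖⁻¹ • u k ∈ Metric.sphere (0 : N → ℝ) 1 := by
    intro k
    rw [mem_sphere_zero_iff_norm, norm_smul, norm_inv, norm_norm,
      inv_mul_cancel₀ (norm_ne_zero_iff.2 (hu k))]
  obtain ⟨u₀, hu₀, φ, hφ, hlim⟩ := (isCompact_sphere (0 : N → ℝ) 1).tendsto_subseq hmem
  have hu₀' : u₀ ≠ 0 := by
    rintro rfl
    simp at hu₀
  have hεlim : Filter.Tendsto (ε ∘ φ) Filter.atTop (nhds 0) :=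
    (squeeze_zero (fun k => (hε k).le) (fun k => (hεlt k).le)
      tendsto_one_div_add_atTop_nhds_zero_nat).comp hφ.tendsto_atTop
  set w : ℕ → N → ℝ := fun k => ‖u (φ k)‖⁻¹ • u (φ k) with hw
  replace hlim : Filter.Tendsto w Filter.atTop (nhds u₀) := hlim
  have hcont : ∀ A : Matrix N N ℝ, Filter.Tendsto (fun k => A *ᵥ w k) Filter.atTop
      (nhds (A *ᵥ u₀)) := fun A =>
    ((continuous_const.matrix_mulVec continuous_id).tendsto u₀).comp hlim
  have heq' : ∀ k, (K + ε (φ k) • R) *ᵥ w k = μ (φ k) • (M *ᵥ w k) := by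
    intro k
    rw [hw, mulVec_smul, heq, mulVec_smul, smul_comm]
  have hw0 : ∀ k, w k ≠ 0 := fun k h0 => by
    have := hmem (φ k)
    rw [show ‖u (φ k)‖⁻¹ • u (φ k) = 0 from h0] at this
    simp at this
  have hpos : ∀ {z : N → ℝ}, z ≠ 0 → 0 < z ⬝ᵥ (M *ᵥ z) := fun hz => by
    simpa using hM.dotProduct_mulVec_pos hz
  have hdot : ∀ {z : ℕ → N → ℝ} {z₀ : N → ℝ}, Filter.Tendsto z Filter.atTop (nhds z₀) →
      Filter.Tendsto (fun k => w k ⬝ᵥ z k) Filter.atTop (nhds (u₀ ⬝ᵥ z₀)) := fun hz =>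
    tendsto_finsetSum _ fun i _ => (tendsto_pi_nhds.1 hlim i).mul (tendsto_pi_nhds.1 hz i)
  have hlhs : Filter.Tendsto (fun k => (K + ε (φ k) • R) *ᵥ w k) Filter.atTop
      (nhds (K *ᵥ u₀)) := by
    have := (hcont K).add (hεlim.smul (hcont R))
    rw [zero_smul, add_zero] at this
    refine this.congr fun k => ?_
    rw [add_mulVec, smul_mulVec]
    rfl
  -- The `μ k` are not assumed bounded; they converge because they are Rayleigh quotients of
  -- converging vectors.
  have hμlim := (hdot hlhs).div (hdot (hcont M)) (hpos hu₀').ne'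
  have hμ : ∀ k, (w k ⬝ᵥ ((K + ε (φ k) • R) *ᵥ w k)) / (w k ⬝ᵥ (M *ᵥ w k)) = μ (φ k) := by
    intro k
    rw [heq', dotProduct_smul, smul_eq_mul, mul_div_cancel_right₀ _ (hpos (hw0 k)).ne']
  have hμlim' := hμlim.congr hμ
  have hrhs := (hμlim'.smul (hcont M)).congr fun k => (heq' k).symm
  have hDw : ∀ k, D *ᵥ w k = 0 := fun k => by
    rw [hw, mulVec_smul, hD, smul_zero]
  have hD₀ : D *ᵥ u₀ = 0 :=
    tendsto_nhds_unique (hcont D) (tendsto_const_nhds.congr fun k => (hDw k).symm)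
  exact ⟨fun k => ε (φ k), fun k => μ (φ k), w, _, u₀, fun k => ⟨hε _, heq' k⟩, hlim, hu₀', hD₀,
    tendsto_nhds_unique hlhs hrhs⟩

/-! ### Weighted Laplacians. -/

section Laplacian

variable {q : ℕ} {w : Fin q → Fin q → ℝ}

theorem lap_eq (hdiag : ∀ i, w i i = 0) :
    lap w = diagonal (fun i => ∑ k, w i k) - of w := by
  ext i j
  by_cases h : i = j
  · subst h; simp [lap, hdiag]
  · simp [lap, h]

theorem lap_isSymm (hsymm : ∀ i j, w i j = w j i) : (lap w)ᵀ = lap w := by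
  ext i j
  by_cases h : i = j
  · subst h; rfl
  · simp [lap, h, Ne.symm h, hsymm i j]

theorem lap_mulVec (hdiag : ∀ i, w i i = 0) (x : Fin q → ℝ) (i : Fin q) :
    (lap w *ᵥ x) i = ∑ j, w i j * (x i - x j) := by
  rw [lap_eq hdiag, sub_mulVec, Pi.sub_apply, mulVec_diagonal, Finset.sum_mul]
  simp [mulVec, dotProduct, mul_sub]

theorem sum_lap_row (hdiag : ∀ i, w i i = 0) (i : Fin q) : ∑ j, lap w i j = 0 := by
  have := lap_mulVec hdiag (fun _ => 1) i
  simpa [mulVec, dotProduct] using this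

theorem sum_lap_col (hdiag : ∀ i, w i i = 0) (hsymm : ∀ i j, w i j = w j i) (j : Fin q) :
    ∑ i, lap w i j = 0 := by
  rw [← sum_lap_row hdiag j]
  exact Finset.sum_congr rfl fun i _ => congrFun (congrFun (lap_isSymm hsymm) j) i

theorem lap_posSemidef (hnonneg : ∀ i j, 0 ≤ w i j) (hsymm : ∀ i j, w i j = w j i)
    (hdiag : ∀ i, w i i = 0) : (lap w).PosSemidef := by
  refine PosSemidef.of_dotProduct_mulVec_nonneg ?_ fun x => ?_
  · rw [IsHermitian, conjTranspose_eq_transpose_of_trivial, lap_isSymm hsymm]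
  · have h1 : star x ⬝ᵥ (lap w *ᵥ x) = ∑ i, ∑ j, w i j * (x i * (x i - x j)) := by
      simp only [star_trivial, dotProduct, lap_mulVec hdiag, Finset.mul_sum]
      exact Finset.sum_congr rfl fun i _ => Finset.sum_congr rfl fun j _ => by ring
    have h2 : star x ⬝ᵥ (lap w *ᵥ x) = ∑ i, ∑ j, w i j * (x j * (x j - x i)) := by
      rw [h1, Finset.sum_comm]
      exact Finset.sum_congr rfl fun i _ => Finset.sum_congr rfl fun j _ => by rw [hsymm]
    have h3 : 2 * (star x ⬝ᵥ (lap w *ᵥ x)) = ∑ i, ∑ j, w i j * (x i - x j) ^ 2 := by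
      rw [two_mul]
      nth_rewrite 1 [h1]
      rw [h2]
      simp only [← Finset.sum_add_distrib]
      exact Finset.sum_congr rfl fun i _ => Finset.sum_congr rfl fun j _ => by ring
    have h4 : 0 ≤ ∑ i, ∑ j, w i j * (x i - x j) ^ 2 :=
      Finset.sum_nonneg fun i _ => Finset.sum_nonneg fun j _ =>
        mul_nonneg (hnonneg i j) (sq_nonneg _)
    linarith

end Laplacian

/-! ### Kronecker products and the exclusion of undamped modes. -/

theorem kronecker_mulVec_apply {q n : ℕ} (A : Matrix (Fin q) (Fin q) ℝ)
    (B : Matrix (Fin n) (Fin n) ℝ) (u : Fin q × Fin n → ℝ) (i : Fin q) (a : Fin n) :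
    ((A ⊗ₖ B) *ᵥ u) (i, a) = ∑ j, A i j * (B *ᵥ fun b => u (j, b)) a := by
  simp only [mulVec, dotProduct, Fintype.sum_prod_type, kroneckerMap_apply, Finset.mul_sum]
  exact Finset.sum_congr rfl fun j _ => Finset.sum_congr rfl fun b _ => by ring

theorem dotProduct_kronecker_mulVec {q n : ℕ} (A : Matrix (Fin q) (Fin q) ℝ)
    (B : Matrix (Fin n) (Fin n) ℝ) (u : Fin q × Fin n → ℝ) (i : Fin q) (v : Fin n → ℝ) :
    (v ⬝ᵥ fun a => ((A ⊗ₖ B) *ᵥ u) (i, a)) = ∑ j, A i j * (v ⬝ᵥ (B *ᵥ fun b => u (j, b))) := by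
  simp only [kronecker_mulVec_apply, dotProduct, Finset.mul_sum]
  rw [Finset.sum_comm]
  exact Finset.sum_congr rfl fun j _ => Finset.sum_congr rfl fun b _ => by ring

theorem reEigenvalue_complexCombine_lap_nonpos {q : ℕ} (hq : 2 ≤ q) {d r : Fin q → Fin q → ℝ}
    (hd_diag : ∀ i, d i i = 0) (hr_diag : ∀ i, r i i = 0) {γ : Fin q → ℝ} {ν : ℝ} (hγ : γ ≠ 0)
    (hsum : ∑ i, γ i = 0) (hd : lap d *ᵥ γ = 0) (hr : lap r *ᵥ γ = ν • γ) :
    reEigenvalue (complexCombine (lap d) (lap r)) ⟨1, hq⟩ ≤ 0 := by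
  have hX : ∀ x : Fin q → ℝ, complexCombine (lap d) (lap r) *ᵥ (Complex.ofRealHom ∘ x) =
      fun i => ((lap d *ᵥ x) i : ℂ) + Complex.I * ((lap r *ᵥ x) i : ℂ) := by
    intro x
    funext i
    rw [complexCombine, add_mulVec, smul_mulVec]
    exact congrArg₂ (fun a b => a + Complex.I * b)
      (RingHom.map_mulVec Complex.ofRealHom (lap d) x i).symm
      (RingHom.map_mulVec Complex.ofRealHom (lap r) x i).symm
  refine reEigenvalue_one_nonpos hq (ν := ν) (v := Complex.ofRealHom ∘ fun _ => 1)
    (w := Complex.ofRealHom ∘ γ) ?_ ?_ ?_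
  -- A constant vector with sum zero vanishes, so `γ` is independent of the ones.
  · rw [LinearIndependent.pair_iff' (fun h => by simpa using congrFun h ⟨0, by omega⟩)]
    intro a ha
    apply hγ
    have hai : ∀ i, (γ i : ℂ) = a := fun i => by simpa using (congrFun ha i).symm
    have hs : ∑ i, (γ i : ℂ) = 0 := by exact_mod_cast hsum
    simp only [hai, Finset.sum_const, Finset.card_univ, Fintype.card_fin, nsmul_eq_mul] at hs
    have ha0 : a = 0 := (mul_eq_zero.1 hs).resolve_left (by norm_cast; omega)
    funext i
    exact_mod_cast (hai i).trans ha0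
  · rw [hX]
    funext i
    rw [lap_mulVec hd_diag, lap_mulVec hr_diag]
    simp
  · rw [hX, hd, hr]
    funext i
    simp [mul_assoc]

/-- The all-ones matrix. -/
def onesMatrix (q : ℕ) : Matrix (Fin q) (Fin q) ℝ := of fun _ _ => 1

/-- For weak restorative coupling no nonzero mode of the array is left undamped by the dissipative
coupling together with a damping of the average. -/
theorem exists_no_undamped_mode {n q md mr : ℕ} (hq : 2 ≤ q)
    {M K : Matrix (Fin n) (Fin n) ℝ} (hM : M.PosDef) (hK : K.PosDef)
    (hdistinct : (pencilPoly M K).roots.Nodup)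
    {Cd : Matrix (Fin md) (Fin n) ℝ} {Cr : Matrix (Fin mr) (Fin n) ℝ}
    {d r : Fin q → Fin q → ℝ} (hd_symm : ∀ i j, d i j = d j i) (hd_diag : ∀ i, d i i = 0)
    (hr_diag : ∀ i, r i i = 0)
    (hlambda : 0 < reEigenvalue (complexCombine (lap d) (lap r)) ⟨1, hq⟩)
    (hobs_d : IsObservablePair Cd (M⁻¹ * K)) (hobs_r : IsObservablePair Cr (M⁻¹ * K)) :
    ∃ ρ : ℝ, 0 < ρ ∧ ∀ ε : ℝ, 0 < ε → ε < ρ → ∀ (u : Fin q × Fin n → ℝ) (μ : ℝ),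
      (lap d ⊗ₖ (Cdᵀ * Cd) + onesMatrix q ⊗ₖ M) *ᵥ u = 0 →
      ((1 : Matrix (Fin q) (Fin q) ℝ) ⊗ₖ K + ε • (lap r ⊗ₖ (Crᵀ * Cr))) *ᵥ u =
        μ • (((1 : Matrix (Fin q) (Fin q) ℝ) ⊗ₖ M) *ᵥ u) → u = 0 := by
  by_contra! hcon
  obtain ⟨ε, μ, u, μ₀, u₀, hk, hlim, hu₀, hD₀, hK₀⟩ :=
    exists_limit_mode (PosDef.one.kronecker hM) hcon
  have hblock : ∀ i, K *ᵥ (fun b => u₀ (i, b)) = μ₀ • (M *ᵥ fun b => u₀ (i, b)) := by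
    intro i
    funext a
    have := congrFun hK₀ (i, a)
    simpa [kronecker_mulVec_apply, one_apply] using this
  obtain ⟨i₀, hi₀⟩ : ∃ i₀, (fun b => u₀ (i₀, b)) ≠ 0 := by
    by_contra! h
    exact hu₀ (funext fun p => congrFun (h p.1) p.2)
  set v : Fin n → ℝ := fun b => u₀ (i₀, b) with hv
  have hKv : K *ᵥ v = μ₀ • (M *ᵥ v) := hblock i₀
  choose γ hγ using fun i => exists_smul_of_pencil_eigenvector hM hdistinct hi₀ hKv (hblock i)
  have hγ₀ : γ i₀ = 1 := by
    have h1 : (1 - γ i₀) • v = 0 := by rw [sub_smul, one_smul, ← hγ i₀, sub_self]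
    linarith [(smul_eq_zero.1 h1).resolve_right hi₀]
  have hAv : (M⁻¹ * K) *ᵥ v = μ₀ • v := by
    rw [← mulVec_mulVec, hKv, mulVec_smul, mulVec_mulVec,
      nonsing_inv_mul _ ((isUnit_iff_isUnit_det _).1 hM.isUnit), one_mulVec]
  have hgram : ∀ {m : ℕ} {C : Matrix (Fin m) (Fin n) ℝ}, IsObservablePair C (M⁻¹ * K) →
      v ⬝ᵥ ((Cᵀ * C) *ᵥ v) ≠ 0 := by
    intro m C hC
    rw [← mulVec_mulVec, dotProduct_mulVec, vecMul_transpose, ne_eq, dotProduct_self_eq_zero]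
    exact mulVec_ne_zero_of_isObservablePair hC hi₀ hAv
  have hMv : v ⬝ᵥ (M *ᵥ v) ≠ 0 := by
    simpa using (hM.dotProduct_mulVec_pos hi₀).ne'
  have hadd : ∀ f g : Fin n → ℝ, (v ⬝ᵥ fun a => f a + g a) = v ⬝ᵥ f + v ⬝ᵥ g := dotProduct_add v
  have hsmul : ∀ (s : ℝ) (f : Fin n → ℝ), (v ⬝ᵥ fun a => s • f a) = s • (v ⬝ᵥ f) := fun s f =>
    dotProduct_smul s v f
  have hdotD : ∀ i, (lap d *ᵥ γ) i * (v ⬝ᵥ ((Cdᵀ * Cd) *ᵥ v)) +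
      (∑ j, γ j) * (v ⬝ᵥ (M *ᵥ v)) = 0 := by
    intro i
    have h : (v ⬝ᵥ fun a => ((lap d ⊗ₖ (Cdᵀ * Cd) +
        onesMatrix q ⊗ₖ M) *ᵥ u₀) (i, a)) = 0 := by
      simp only [hD₀]
      exact dotProduct_zero v
    simp only [add_mulVec, Pi.add_apply] at h
    rw [hadd] at h
    simp only [dotProduct_kronecker_mulVec, hγ, mulVec_smul, dotProduct_smul, smul_eq_mul,
      onesMatrix, of_apply, one_mul] at h
    rw [mulVec, dotProduct, Finset.sum_mul, Finset.sum_mul]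
    simpa only [mul_assoc] using h
  have hsumγ : ∑ j, γ j = 0 := by
    -- Summing over the blocks kills the Laplacian term, whose columns sum to zero.
    have h := Finset.sum_eq_zero (s := Finset.univ) fun i _ => hdotD i
    have hlap : ∑ i, (lap d *ᵥ γ) i = 0 := by
      simp only [mulVec, dotProduct]
      rw [Finset.sum_comm]
      simp only [← Finset.sum_mul, sum_lap_col hd_diag hd_symm, zero_mul, Finset.sum_const_zero]
    rw [Finset.sum_add_distrib, ← Finset.sum_mul, hlap, zero_mul, zero_add, Finset.sum_const,
      Finset.card_univ, Fintype.card_fin, nsmul_eq_mul] at h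
    have hq0 : (q : ℝ) ≠ 0 := by norm_cast; omega
    exact (mul_eq_zero.1 ((mul_eq_zero.1 h).resolve_left hq0)).resolve_right hMv
  have hdγ : lap d *ᵥ γ = 0 := by
    funext i
    have h := hdotD i
    rw [hsumγ, zero_mul, add_zero] at h
    exact (mul_eq_zero.1 h).resolve_right (hgram hobs_d)
  -- Pairing block `i` of the perturbed mode equation with `v` replaces `K` by `μ₀ M`, leaving `ε G
  -- i = (μ - μ₀) c i`.
  let G : Fin q → (Fin q × Fin n → ℝ) → ℝ := fun i z =>
    ∑ j, lap r i j * (v ⬝ᵥ ((Crᵀ * Cr) *ᵥ fun b => z (j, b)))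
  let c : Fin q → (Fin q × Fin n → ℝ) → ℝ := fun i z => v ⬝ᵥ (M *ᵥ fun b => z (i, b))
  have hG : ∀ i, Continuous (G i) := fun i => by
    simp only [G, mulVec, dotProduct]; fun_prop
  have hc : ∀ i, Continuous (c i) := fun i => by
    simp only [c, mulVec, dotProduct]; fun_prop
  have hKc : ∀ i z, v ⬝ᵥ (K *ᵥ fun b => z (i, b)) = μ₀ * c i z := by
    intro i z
    have hsym : ∀ {A : Matrix (Fin n) (Fin n) ℝ}, A.IsHermitian → ∀ x : Fin n → ℝ,
        v ⬝ᵥ (A *ᵥ x) = (A *ᵥ v) ⬝ᵥ x := by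
      intro A hA x
      rw [dotProduct_mulVec, ← mulVec_transpose, ← conjTranspose_eq_transpose_of_trivial, hA]
    simp only [c]
    rw [hsym hK.isHermitian, hsym hM.isHermitian, hKv, smul_dotProduct, smul_eq_mul]
  have hfirst : ∀ k i, ε k * G i (u k) = (μ k - μ₀) * c i (u k) := by
    intro k i
    have h : (v ⬝ᵥ fun a => (((1 : Matrix (Fin q) (Fin q) ℝ) ⊗ₖ K +
        ε k • (lap r ⊗ₖ (Crᵀ * Cr))) *ᵥ u k) (i, a)) =
        v ⬝ᵥ fun a => (μ k • (((1 : Matrix (Fin q) (Fin q) ℝ) ⊗ₖ M) *ᵥ u k)) (i, a) := by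
      rw [(hk k).2]
    simp only [add_mulVec, smul_mulVec, Pi.add_apply, Pi.smul_apply] at h
    rw [hadd, hsmul, hsmul] at h
    simp only [dotProduct_kronecker_mulVec, one_apply, ite_mul, one_mul, zero_mul,
      Finset.sum_ite_eq, Finset.mem_univ, if_true, smul_eq_mul, hKc] at h
    simp only [G, c] at h ⊢
    linear_combination h
  -- Cross-multiplication eliminates `(μ - μ₀) / ε`, whose convergence is not yet known; the
  -- resulting identity is closed and passes to the limit.
  have hcross : ∀ i, G i u₀ * c i₀ u₀ = G i₀ u₀ * c i u₀ := by
    intro i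
    have hclosed : IsClosed {z | G i z * c i₀ z = G i₀ z * c i z} :=
      isClosed_eq ((hG i).mul (hc i₀)) ((hG i₀).mul (hc i))
    refine hclosed.mem_of_tendsto hlim (Filter.Eventually.of_forall fun k => ?_)
    apply mul_left_cancel₀ (hk k).1.ne'
    linear_combination c i₀ (u k) * hfirst k i - c i (u k) * hfirst k i₀
  have hGγ : ∀ i, G i u₀ = (lap r *ᵥ γ) i * (v ⬝ᵥ ((Crᵀ * Cr) *ᵥ v)) := by
    intro i
    simp only [G, hγ, mulVec_smul, dotProduct_smul, smul_eq_mul, ← mul_assoc, ← Finset.sum_mul]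
    rfl
  have hcγ : ∀ i, c i u₀ = γ i * (v ⬝ᵥ (M *ᵥ v)) := by
    intro i
    simp only [c, hγ, mulVec_smul, dotProduct_smul, smul_eq_mul]
  have hrγ : lap r *ᵥ γ = (lap r *ᵥ γ) i₀ • γ := by
    funext i
    have h := hcross i
    rw [hGγ, hGγ, hcγ, hcγ, hγ₀] at h
    apply mul_right_cancel₀ (mul_ne_zero (hgram hobs_r) hMv)
    rw [Pi.smul_apply, smul_eq_mul]
    linear_combination h
  refine absurd hlambda (not_lt.2 (reEigenvalue_complexCombine_lap_nonpos hq hd_diag hr_diag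
    (fun h => ?_) hsumγ hdγ hrγ))
  rw [h] at hγ₀
  exact zero_ne_one hγ₀

/-! ### Centering and the equation of the deviations. -/

/-- The projection of `ℝ^q` along the constant vectors onto the vectors with sum zero. -/
noncomputable def centering (q : ℕ) : Matrix (Fin q) (Fin q) ℝ := 1 - (q : ℝ)⁻¹ • onesMatrix q

theorem onesMatrix_posSemidef (q : ℕ) : (onesMatrix q).PosSemidef := by
  convert posSemidef_vecMulVec_self_star (fun _ : Fin q => (1 : ℝ)) using 1
  ext i j
  simp [onesMatrix, vecMulVec_apply]

theorem onesMatrix_mul_centering {q : ℕ} (hq : q ≠ 0) : onesMatrix q * centering q = 0 := by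
  have h : onesMatrix q * onesMatrix q = (q : ℝ) • onesMatrix q := by
    ext i j
    simp [onesMatrix, mul_apply]
  rw [centering, mul_sub, mul_one, mul_smul_comm, h, smul_smul,
    inv_mul_cancel₀ (Nat.cast_ne_zero.2 hq), one_smul, sub_self]

theorem lap_mul_centering {q : ℕ} {w : Fin q → Fin q → ℝ} (hdiag : ∀ i, w i i = 0) :
    lap w * centering q = lap w := by
  have h : lap w * onesMatrix q = 0 := by
    ext i j
    simp [onesMatrix, mul_apply, sum_lap_row hdiag]
  rw [centering, mul_sub, mul_one, mul_smul_comm, h, smul_zero, sub_zero]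

theorem centering_mul_lap {q : ℕ} {w : Fin q → Fin q → ℝ} (hdiag : ∀ i, w i i = 0)
    (hsymm : ∀ i j, w i j = w j i) : centering q * lap w = lap w := by
  have h : onesMatrix q * lap w = 0 := by
    ext i j
    simp [onesMatrix, mul_apply, sum_lap_col hdiag hsymm]
  rw [centering, sub_mul, one_mul, smul_mul_assoc, h, smul_zero, sub_zero]

theorem centering_mulVec_apply {q : ℕ} (x : Fin q → ℝ) (i : Fin q) :
    (centering q *ᵥ x) i = x i - (q : ℝ)⁻¹ * ∑ k, x k := by
  rw [centering, sub_mulVec, one_mulVec, smul_mulVec, Pi.sub_apply, Pi.smul_apply, smul_eq_mul]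
  simp [onesMatrix, mulVec, dotProduct]

theorem sum_smul_mulVec_sub_apply {q n : ℕ} {w : Fin q → Fin q → ℝ} (hdiag : ∀ i, w i i = 0)
    (B : Matrix (Fin n) (Fin n) ℝ) (z : Fin q → Fin n → ℝ) (i : Fin q) (a : Fin n) :
    (∑ j, (w i j • B) *ᵥ (z i - z j)) a = ((lap w ⊗ₖ B) *ᵥ fun p => z p.1 p.2) (i, a) := by
  rw [kronecker_mulVec_apply]
  refine Eq.trans ?_ (lap_mulVec hdiag (fun j => (B *ᵥ z j) a) i).symm
  simp only [Finset.sum_apply, smul_mulVec, mulVec_sub, Pi.smul_apply, Pi.sub_apply, smul_eq_mul,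
    mul_sub]

theorem transpose_mul_self_posSemidef {m n : ℕ} (C : Matrix (Fin m) (Fin n) ℝ) :
    (Cᵀ * C).PosSemidef := by
  rw [← conjTranspose_eq_transpose_of_trivial]
  exact posSemidef_conjTranspose_mul_self C

/-- Centering commutes with the Laplacians and with the identity, so it maps the array equation to
itself; the extra damping vanishes on centered vectors. -/
theorem IsArraySolution.centered_equation {n q md mr : ℕ} (hq : q ≠ 0)
    {M K : Matrix (Fin n) (Fin n) ℝ}
    {Cd : Matrix (Fin md) (Fin n) ℝ} {Cr : Matrix (Fin mr) (Fin n) ℝ}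
    {d r : Fin q → Fin q → ℝ}
    (hd_symm : ∀ i j, d i j = d j i) (hd_diag : ∀ i, d i i = 0)
    (hr_symm : ∀ i j, r i j = r j i) (hr_diag : ∀ i, r i i = 0) {ε : ℝ}
    {x v a : ℝ → Fin q → Fin n → ℝ}
    (h : IsArraySolution M K (fun i j => d i j • (Cdᵀ * Cd))
      (fun i j => ε • (r i j • (Crᵀ * Cr))) x v a) {t : ℝ} (ht : 0 ≤ t) :
    ((1 : Matrix (Fin q) (Fin q) ℝ) ⊗ₖ M) *ᵥ ((centering q ⊗ₖ 1) *ᵥ fun p => a t p.1 p.2) +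
      (lap d ⊗ₖ (Cdᵀ * Cd) + onesMatrix q ⊗ₖ M) *ᵥ ((centering q ⊗ₖ 1) *ᵥ fun p => v t p.1 p.2) +
      ((1 : Matrix (Fin q) (Fin q) ℝ) ⊗ₖ K + ε • (lap r ⊗ₖ (Crᵀ * Cr))) *ᵥ
        ((centering q ⊗ₖ 1) *ᵥ fun p => x t p.1 p.2) = 0 := by
  have hflat : ((1 : Matrix (Fin q) (Fin q) ℝ) ⊗ₖ M) *ᵥ (fun p => a t p.1 p.2) +
      (lap d ⊗ₖ (Cdᵀ * Cd)) *ᵥ (fun p => v t p.1 p.2) +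
      ((1 : Matrix (Fin q) (Fin q) ℝ) ⊗ₖ K + ε • (lap r ⊗ₖ (Crᵀ * Cr))) *ᵥ
        (fun p => x t p.1 p.2) = 0 := by
    funext p
    obtain ⟨i, b⟩ := p
    have heq := congrFun (h.equation t ht i) b
    simp only [smul_mulVec ε, ← Finset.smul_sum, Pi.add_apply, Pi.smul_apply,
      sum_smul_mulVec_sub_apply hd_diag, sum_smul_mulVec_sub_apply hr_diag] at heq
    simp only [add_mulVec, smul_mulVec, Pi.add_apply, Pi.smul_apply]
    have hone : ∀ (A : Matrix (Fin n) (Fin n) ℝ) (z : Fin q → Fin n → ℝ),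
        (((1 : Matrix (Fin q) (Fin q) ℝ) ⊗ₖ A) *ᵥ fun p => z p.1 p.2) (i, b) = (A *ᵥ z i) b := by
      intro A z
      simp [kronecker_mulVec_apply, one_apply]
    rw [hone, hone]
    refine Eq.trans ?_ heq
    ring
  have hcomm : ∀ {A B : Matrix (Fin q) (Fin q) ℝ} (S : Matrix (Fin n) (Fin n) ℝ),
      A * centering q = centering q * B →
      (A ⊗ₖ S) * (centering q ⊗ₖ (1 : Matrix (Fin n) (Fin n) ℝ)) =
        (centering q ⊗ₖ (1 : Matrix (Fin n) (Fin n) ℝ)) * (B ⊗ₖ S) := by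
    intro A B S hAB
    rw [← mul_kronecker_mul, ← mul_kronecker_mul, hAB, mul_one, one_mul]
  have hlap : ∀ {w : Fin q → Fin q → ℝ}, (∀ i, w i i = 0) → (∀ i j, w i j = w j i) →
      lap w * centering q = centering q * lap w := fun h1 h2 => by
    rw [lap_mul_centering h1, centering_mul_lap h1 h2]
  have hJ : onesMatrix q * centering q = centering q * 0 := by
    rw [onesMatrix_mul_centering hq, mul_zero]
  have hone : (1 : Matrix (Fin q) (Fin q) ℝ) * centering q = centering q * 1 := by
    rw [one_mul, mul_one]
  simp only [mulVec_mulVec, add_mul, smul_mul_assoc, hcomm M hone, hcomm K hone, hcomm M hJ,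
    hcomm _ (hlap hd_diag hd_symm), hcomm _ (hlap hr_diag hr_symm), zero_kronecker, mul_zero,
    add_zero]
  rw [← mul_smul_comm, ← mul_add, ← mulVec_mulVec, ← mulVec_mulVec, ← mulVec_mulVec,
    ← mulVec_add, ← mulVec_add, hflat, mulVec_zero]

/-! ### Synchronization for weak restorative coupling. -/

theorem mainTheorem4 {n q md mr : ℕ} (hq : 2 ≤ q)
    (M K : Matrix (Fin n) (Fin n) ℝ) (hM : M.PosDef) (hK : K.PosDef)
    (hdistinct : (pencilPoly M K).roots.Nodup)
    (Cd : Matrix (Fin md) (Fin n) ℝ) (Cr : Matrix (Fin mr) (Fin n) ℝ)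
    (d r : Fin q → Fin q → ℝ)
    (hd_nonneg : ∀ i j, 0 ≤ d i j) (hd_symm : ∀ i j, d i j = d j i) (hd_diag : ∀ i, d i i = 0)
    (hr_nonneg : ∀ i j, 0 ≤ r i j) (hr_symm : ∀ i j, r i j = r j i) (hr_diag : ∀ i, r i i = 0)
    (hlambda : 0 < reEigenvalue (complexCombine (lap d) (lap r)) ⟨1, hq⟩)
    (hobs_d : IsObservablePair Cd (M⁻¹ * K)) (hobs_r : IsObservablePair Cr (M⁻¹ * K)) :
    ∃ ρ : ℝ, 0 < ρ ∧ ∀ ε : ℝ, 0 < ε → ε < ρ →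
      Synchronizes M K (fun i j => d i j • (Cdᵀ * Cd))
        (fun i j => ε • (r i j • (Crᵀ * Cr))) := by
  obtain ⟨ρ, hρ, hmode⟩ := exists_no_undamped_mode hq hM hK hdistinct hd_symm hd_diag hr_diag
    hlambda hobs_d hobs_r
  refine ⟨ρ, hρ, fun ε hε hερ x v a hsol i j => ?_⟩
  have hderiv : ∀ {z : ℝ → Fin q → Fin n → ℝ} {z' : Fin q → Fin n → ℝ} {t : ℝ},
      HasDerivWithinAt z z' (Set.Ici 0) t → HasDerivWithinAt
        (fun t => (centering q ⊗ₖ (1 : Matrix (Fin n) (Fin n) ℝ)) *ᵥ fun p => z t p.1 p.2)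
        ((centering q ⊗ₖ (1 : Matrix (Fin n) (Fin n) ℝ)) *ᵥ fun p => z' p.1 p.2)
        (Set.Ici 0) t := by
    intro z z' t hz
    have hflat : HasDerivWithinAt (fun t (p : Fin q × Fin n) => z t p.1 p.2)
        (fun p => z' p.1 p.2) (Set.Ici 0) t := by
      rw [hasDerivWithinAt_pi]
      intro p
      exact hasDerivWithinAt_pi.1 (hasDerivWithinAt_pi.1 hz p.1) p.2
    exact (LinearMap.toContinuousLinearMap (centering q ⊗ₖ
      (1 : Matrix (Fin n) (Fin n) ℝ)).mulVecLin).hasFDerivAt.comp_hasDerivWithinAt t hflat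
  have hlim := tendsto_zero_of_no_undamped_mode (PosDef.one.kronecker hM)
    (((lap_posSemidef hd_nonneg hd_symm hd_diag).kronecker (transpose_mul_self_posSemidef Cd)).add
      ((onesMatrix_posSemidef q).kronecker hM.posSemidef))
    ((PosDef.one.kronecker hK).add_posSemidef
      (((lap_posSemidef hr_nonneg hr_symm hr_diag).kronecker
        (transpose_mul_self_posSemidef Cr)).smul hε.le))
    (hmode ε hε hερ) (fun t ht => hderiv (hsol.hasDeriv_pos t ht))
    (fun t ht => hderiv (hsol.hasDeriv_vel t ht))
    (fun t ht => hsol.centered_equation (by omega) hd_symm hd_diag hr_symm hr_diag ht)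
  have hdiff : Filter.Tendsto (fun t => x t i - x t j) Filter.atTop (nhds 0) := by
    rw [tendsto_pi_nhds] at hlim ⊢
    intro b
    have h := (hlim (i, b)).sub (hlim (j, b))
    -- The average cancels in the difference of two centered blocks.
    have hcent : ∀ (t : ℝ) (k : Fin q), ((centering q ⊗ₖ (1 : Matrix (Fin n) (Fin n) ℝ)) *ᵥ
        fun p => x t p.1 p.2) (k, b) = x t k b - (q : ℝ)⁻¹ * ∑ l, x t l b := by
      intro t k
      rw [kronecker_mulVec_apply]
      simp only [one_mulVec]
      exact centering_mulVec_apply (fun l => x t l b) k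
    simpa [hcent] using h
  have h := (((PiLp.continuous_toLp 2 fun _ : Fin n => ℝ).tendsto 0).comp hdiff).norm
  simpa using h
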